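/- **Setting.** Directed graphs are finite; self-loops are allowed. A *source* of a graph is a vertex without parents, a *leaf* is a vertex without outgoing edges, and a graph is *trivial* if it has exactly one vertex. Two distinct vertices are *siblings* if they share a parent. A *siblings-on-cycles (SOC) graph* is a directed graph in which every directed cycle contains a pair of siblings. $\mathrm{Pa}_D(v)$ and $\mathrm{Ch}_D(v)$ denote the sets of parents and children of $v$ in $D$. A *causal model* $(D,\mathcal F)$ consists of a directed graph $D$ whose vertices $v$ (agents) carry finite input spaces $\mathcal I_v$ and finite non-empty output spaces $\mathcal O_v$, and a family $\mathcal F$ of functions $\omega_v:\mathcal O_{\mathrm{Pa}_D(v)}\to\mathcal I_v$, where $\mathcal O_{S}=\prod_{u\in S}\mathcal O_u$. The function $\omega_v$ is *signaling* from $\ell\in\mathrm{Pa}_D(v)$ if there are $\hat o\in\mathcal O_{\mathrm{Pa}_D(v)\setminus\{\ell\}}$ and $q,r\in\mathcal O_\ell$ with $\omega_v(q,\hat o)\neq\omega_v(r,\hat o)$. The model is *faithful* if each $\omega_v$ is signaling from each $\ell\in\mathrm{Pa}_D(v)$. It is *consistent*, with respect to given non-empty sets $\mathcal X_v$ of settings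 and $\mathcal A_v$ of results, if for any interventions $\mu_v:\mathcal X_v\times\mathcal I_v\to\mathcal A_v\times\mathcal O_v$ there is a function $g:\prod_v\mathcal X_v\to\prod_v\mathcal A_v$ such that for all $x\in\prod_v\mathcal X_v$, $a\in\prod_v\mathcal A_v$ $$\sum_{i\in\prod_v\mathcal I_v,\;o\in\prod_v\mathcal O_v}\bigl[\forall v:\ \omega_v(o_{\mathrm{Pa}_D(v)})=i_v\bigr]\,\bigl[\forall v:\ \mu_v(x_v,i_v)=(a_v,o_v)\bigr]=[g(x)=a],$$ where $[p]$ is $1$ if $p$ holds and $0$ otherwise. **Algorithm 1 (flow).** On input $(D,\mathcal F)$, start with the graph $\mathscr G$ whose only vertex is $(D,\mathcal F)$. As long as $\mathscr G$ has leaves $(L,\mathcal F_L)$ such that $L$ is non-trivial and has a source, do the following: for all these leaves, all sources $s$ of $L$ and all $o_s\in\mathcal O_s$, remove $s$ and all its edges from $L$, replace $\omega_v$ by its partial application $\omega_v(o_s,\cdot)$ for $v\in\mathrm{Ch}_L(s)$, delete every edge $\ell\to v$ for which the new parameter of $v$ is not signaling from $\ell$ (and drop the corresponding argument), and add to $\mathscr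 G$ the edge from $(L,\mathcal F_L)$ to the resulting model $(L',\mathcal F_L')$. Finally discard the model parameters: the *flow* $\mathscr F$ is the image of $\mathscr G$ under $(L,\mathcal F_L)\mapsto L$. **Algorithm 2 (superflow).** On input $D$, start with the graph $\mathscr S$ whose only vertex is $D$. As long as $\mathscr S$ has leaves $L$ such that $L$ is non-trivial and has a source, do the following: for all these leaves and all sources $s$ of $L$, let $L'$ be $L$ without $s$ and its edges, let $\mathcal E=\{v\to k\mid k\in\mathrm{Ch}_L(s),\,v\in\mathrm{Pa}_{L'}(k)\}$, and for every $\mathcal R\subseteq\mathcal E$ such that $L''=L'\setminus\mathcal R$ is an SOC graph, add the edge $L\to L''$ to $\mathscr S$. The final graph $\mathscr S$ is the *superflow*. **Theorem.** 1. Algorithm 2 terminates after finitely many steps on every finite SOC graph $D$. 2. Let $(D,\mathcal F)$ be a consistent and faithful causal model. Then Algorithm 2 terminates on $D$, Algorithm 1 terminates on $(D,\mathcal F)$, and for the resulting superflow $\mathscr S$ and flow $\mathscr F$, the flow $\mathscr F$ is a subgraph of $\mathscr S$, and every directed path $D_1\to D_2\to\dots\to D_\ell$ in $\mathscr F$ (in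 particular, every path starting at the root $D_1=D$) is also a path in $\mathscr S$. -/

import Mathlib

namespace CausalFlow

/-- A directed graph whose vertices form a subset of an ambient type (so that vertices can be
removed). Self-loops are allowed. The same structure is used for causal structures, whose vertices
are agents, and for flow graphs, whose vertices are causal models or causal structures. -/
@[ext]
structure DirGraph (α : Type*) where
  verts : Set α
  Adj : α → α → Prop
  left_mem : ∀ {a b : α}, Adj a b → a ∈ verts
  right_mem : ∀ {a b : α}, Adj a b → b ∈ verts

namespace DirGraph

variable {α β : Type*}

/-- `G` is a subgraph of `H` (equivalently, `H` is a supergraph of `G`). -/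
def IsSubgraph (G H : DirGraph α) : Prop :=
  G.verts ⊆ H.verts ∧ ∀ a b : α, G.Adj a b → H.Adj a b

/-- The graph with the single vertex `a` and no edge. -/
def single (a : α) : DirGraph α where
  verts := {a}
  Adj _ _ := False
  left_mem h := h.elim
  right_mem h := h.elim

/-- Add all the edges `a ⟶ b` with `r a b`, together with their endpoints. -/
def addEdges (G : DirGraph α) (r : α → α → Prop) : DirGraph α where
  verts := G.verts ∪ {c | (∃ b, r c b) ∨ ∃ a, r a c}
  Adj a b := G.Adj a b ∨ r a b
  left_mem := by
    rintro a b (h | h)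
    · exact Or.inl (G.left_mem h)
    · exact Or.inr (Or.inl ⟨b, h⟩)
  right_mem := by
    rintro a b (h | h)
    · exact Or.inl (G.right_mem h)
    · exact Or.inr (Or.inr ⟨a, h⟩)

/-- Remove the vertex `s` and all the edges starting from or ending in `s`. -/
def removeVertex (G : DirGraph α) (s : α) : DirGraph α where
  verts := G.verts \ {s}
  Adj a b := G.Adj a b ∧ a ≠ s ∧ b ≠ s
  left_mem h := ⟨G.left_mem h.1, h.2.1⟩
  right_mem h := ⟨G.right_mem h.1, h.2.2⟩

/-- Remove the edges in `R` (and no vertex). -/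
def removeEdges (G : DirGraph α) (R : Set (α × α)) : DirGraph α where
  verts := G.verts
  Adj a b := G.Adj a b ∧ (a, b) ∉ R
  left_mem h := G.left_mem h.1
  right_mem h := G.right_mem h.1

/-- The image of a graph under a map of its vertices: an edge `a ⟶ b` is mapped to `f a ⟶ f b`. -/
def image (f : α → β) (G : DirGraph α) : DirGraph β where
  verts := f '' G.verts
  Adj x y := ∃ a b, G.Adj a b ∧ f a = x ∧ f b = y
  left_mem := by
    rintro x y ⟨a, b, h, rfl, rfl⟩
    exact ⟨a, G.left_mem h, rfl⟩
  right_mem := by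
    rintro x y ⟨a, b, h, rfl, rfl⟩
    exact ⟨b, G.right_mem h, rfl⟩

/-- A source is a parentless vertex. -/
def IsSource (G : DirGraph α) (s : α) : Prop :=
  s ∈ G.verts ∧ ∀ a, ¬ G.Adj a s

/-- A leaf is a vertex without outgoing edges. -/
def IsLeaf (G : DirGraph α) (a : α) : Prop :=
  a ∈ G.verts ∧ ∀ b, ¬ G.Adj a b

/-- A trivial graph is a graph composed of a single vertex. -/
def IsTrivial (G : DirGraph α) : Prop :=
  ∃ a, G.verts = {a}

/-- The list `[D₁, …, D_ℓ]`, `ℓ ≥ 1`, is a directed path `D₁ ⟶ ⋯ ⟶ D_ℓ` of the graph `G`.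
Repeated vertices are not excluded. -/
def IsPath (G : DirGraph α) (p : List α) : Prop :=
  p ≠ [] ∧ (∀ a ∈ p, a ∈ G.verts) ∧ p.IsChain G.Adj

/-- A directed cycle `c 0 ⟶ c 1 ⟶ ⋯ ⟶ c n ⟶ c 0` through `n + 1` distinct vertices; the index
`i + 1` is taken modulo `n + 1`, and a self-loop is a cycle with `n = 0`. -/
def IsCycle (G : DirGraph α) {n : ℕ} (c : Fin (n + 1) → α) : Prop :=
  Function.Injective c ∧ ∀ i, G.Adj (c i) (c (i + 1))

/-- Two distinct vertices are siblings if they share at least one parent. -/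
def Siblings (G : DirGraph α) (a b : α) : Prop :=
  a ≠ b ∧ ∃ p, G.Adj p a ∧ G.Adj p b

/-- Siblings-on-cycles graphs: every directed cycle contains a pair of siblings. -/
def IsSOC (G : DirGraph α) : Prop :=
  ∀ (n : ℕ) (c : Fin (n + 1) → α), G.IsCycle c → ∃ i j, G.Siblings (c i) (c j)

end DirGraph

/-- A classical-deterministic causal model on agents from `V`, where the agent `v` has the output
space `O v` and the input space `I v`: a causal structure `graph`, and for each agent `v` a function
`param v` from the outputs of the parents of `v` to the inputs of `v`. -/
structure CausalModel {V : Type*} (O I : V → Type*) where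
  graph : DirGraph V
  param : ∀ v : graph.verts, (∀ u : {u : V // graph.Adj u v}, O u) → I v

/-- `[p]` is one if `p` holds, and zero otherwise. -/
noncomputable def bracket (p : Prop) : ℕ :=
  open scoped Classical in if p then 1 else 0

namespace CausalModel

variable {V : Type*} {O I : V → Type*}

/-- Consistency, for spaces `X v` of settings and `A v` of results: for any choice of
interventions `μ v : X v × I v → A v × O v` of all agents, the contraction with the model
parameters is a function `g` from settings to results. The sum over all inputs `i` and outputs `o`
of all agents is a finite sum for finite `V`, `I v` and `O v`. -/
def Consistent (M : CausalModel O I) (X A : V → Type*) : Prop :=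
  ∀ μ : (∀ v : M.graph.verts, X v × I v → A v × O v),
    ∃ g : (∀ v : M.graph.verts, X v) → (∀ v : M.graph.verts, A v),
      ∀ (x : ∀ v : M.graph.verts, X v) (a : ∀ v : M.graph.verts, A v),
        ∑ᶠ io : (∀ v : M.graph.verts, I v) × (∀ v : M.graph.verts, O v),
          bracket (∀ v : M.graph.verts,
              M.param v (fun u => io.2 ⟨u, M.graph.left_mem u.2⟩) = io.1 v) *
            bracket (∀ v : M.graph.verts, μ v (x v, io.1 v) = (a v, io.2 v))
          = bracket (g x = a)

open scoped Classical in
/-- The model parameter of `v` is signaling from the parent `l` of `v`: for some outputs of the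
other parents, it takes different values for two outputs `q`, `r` of `l`. -/
def Signals (M : CausalModel O I) (l v : V) : Prop :=
  ∃ h : M.graph.Adj l v, ∃ (o : ∀ u : {u : V // M.graph.Adj u v}, O u) (q r : O l),
    M.param ⟨v, M.graph.right_mem h⟩ (Function.update o ⟨l, h⟩ q) ≠
      M.param ⟨v, M.graph.right_mem h⟩ (Function.update o ⟨l, h⟩ r)

/-- Each model parameter is signaling from each parent. -/
def Faithful (M : CausalModel O I) : Prop :=
  ∀ l v : V, M.graph.Adj l v → M.Signals l v

open scoped Classical in
/-- The model parameters after reduction over `s` with output `os`, on the graph without `s`: the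
value `os` is plugged into the parameters of the children of `s`, and the other parameters are
unchanged. -/
noncomputable def reduce (M : CausalModel O I) (s : V) (os : O s) : CausalModel O I where
  graph := M.graph.removeVertex s
  param v := fun o =>
    M.param ⟨v, v.2.1⟩ fun u =>
      if h : (u : V) = s then cast (congrArg O h.symm) os else o ⟨u, u.2, h, v.2.2⟩

/-- The causal structure of the functional dependencies of the model parameters. -/
def dependencyGraph (M : CausalModel O I) : DirGraph V where
  verts := M.graph.verts
  Adj l v := M.Signals l v
  left_mem h := M.graph.left_mem h.1
  right_mem h := M.graph.right_mem h.1

open scoped Classical in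
/-- The same model, but with the causal structure derived from the functional dependencies.
The model parameters do not depend on the arguments that are dropped; these are filled in
arbitrarily. -/
noncomputable def derive [∀ v, Nonempty (O v)] (M : CausalModel O I) : CausalModel O I where
  graph := M.dependencyGraph
  param v := fun o =>
    M.param v fun u =>
      if h : M.Signals u v then o ⟨u, h⟩ else Classical.arbitrary (O u)

end CausalModel

/-- The loop "while not `done`, replace the state by `step state`", started in `init`, ends after
finitely many iterations with the final state `out`. -/
def WhileReturns {σ : Type*} (done : σ → Prop) (step : σ → σ) (init out : σ) : Prop :=
  ∃ k : ℕ, (∀ j < k, ¬ done (step^[j] init)) ∧ done (step^[k] init) ∧ out = step^[k] init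

section Algorithms

variable {V : Type*} {O I : V → Type*}

/-- A node, with causal structure `str node`, is a leaf of `G`, its causal structure is not trivial,
and its causal structure has at least one source. -/
def NontrivialLeafWithSource {α : Type*} (str : α → DirGraph V) (G : DirGraph α) (a : α) : Prop :=
  G.IsLeaf a ∧ ¬ (str a).IsTrivial ∧ ∃ s, (str a).IsSource s

/-- One iteration of the flow algorithm: for all nontrivial leaves `M` with a source, all sources
`s` of `M` and all outputs `os` of `s`, add an edge from `M` to the model reduced over `s` with `os`,
with its causal structure derived from the reduced model parameters. -/
noncomputable def flowStep [∀ v, Nonempty (O v)] (G : DirGraph (CausalModel O I)) :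
    DirGraph (CausalModel O I) :=
  G.addEdges fun M N =>
    NontrivialLeafWithSource CausalModel.graph G M ∧
      ∃ s, M.graph.IsSource s ∧ ∃ os : O s, N = (M.reduce s os).derive

/-- The flow algorithm (using the model parameters) terminates on the causal model `M`, and returns
the flow `F`: starting with the root `M`, iterate as long as there are nontrivial leaves with a
source, and then discard the model parameters. -/
def FlowReturns [∀ v, Nonempty (O v)] (M : CausalModel O I) (F : DirGraph (DirGraph V)) : Prop :=
  ∃ G : DirGraph (CausalModel O I),
    WhileReturns (fun G => ∀ N, ¬ NontrivialLeafWithSource CausalModel.graph G N) flowStep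
      (DirGraph.single M) G ∧
    F = G.image CausalModel.graph

/-- The edges `v ⟶ k` of `L` without `s` that point to children `k` of `s` in `L`. -/
def edgesIntoChildren (L : DirGraph V) (s : V) : Set (V × V) :=
  {e | L.Adj s e.2 ∧ (L.removeVertex s).Adj e.1 e.2}

/-- One iteration of the superflow algorithm: for all nontrivial leaves `L` with a source, all
sources `s` of `L` and all sets `R` of edges into children of `s`, add an edge from `L` to the graph
obtained from `L` by removing `s` and `R`, if that graph is a siblings-on-cycles graph. -/
def superflowStep (S : DirGraph (DirGraph V)) : DirGraph (DirGraph V) :=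
  S.addEdges fun L L'' =>
    NontrivialLeafWithSource id S L ∧
      ∃ s, L.IsSource s ∧ ∃ R ⊆ edgesIntoChildren L s,
        L'' = (L.removeVertex s).removeEdges R ∧ L''.IsSOC

/-- The superflow algorithm (using the causal structure only) terminates on the causal structure
`D`, and returns the superflow `S`: starting with the root `D`, iterate as long as there are
nontrivial leaves with a source. -/
def SuperflowReturns (D : DirGraph V) (S : DirGraph (DirGraph V)) : Prop :=
  WhileReturns (fun S => ∀ L, ¬ NontrivialLeafWithSource id S L) superflowStep
    (DirGraph.single D) S

end Algorithms

end CausalFlow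

/-!
The proof rests on one characterization and one construction.

Consistency says that for any interventions the number of solutions is exactly one. Interventions
with a constant result turn this into a statement about functions `f v : I v → O v` alone: the
equations `f v (ω_v (o_Pa(v))) = o v` have exactly one solution `o`
(`CausalModel.Consistent.hasUniqueFixedPoints`). This property passes to reduced models, since a
source `s` can be made to output `os` constantly, and to derived models, since dropping arguments
on which a function does not depend does not change it.

A faithful model with unique fixed points lives on a siblings-on-cycles graph
(`CausalModel.isSOC_of_hasUniqueFixedPoints`). On a cycle without siblings, a vertex is a
parent of at most one vertex of the cycle. Therefore the outputs witnessing that each vertex of the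
cycle is signaled to by its predecessor can be chosen simultaneously, and there are two assignments
`Q`, `R` of outputs that differ on the cycle only and such that every vertex of the cycle
receives different inputs under `Q` and under `R`. Interventions that reproduce `Q` or `R`, according
to the input, then have both assignments as fixed points.

Consequently each edge of the flow is an edge that the superflow algorithm may add: the reduction
over `s` loses edges into children of `s` only, and the reduced graph is a siblings-on-cycles graph
again. A vertex of the superflow that is expanded at all gets all its permitted edges at once, so
the flow embeds into the superflow. Both algorithms terminate because each edge strictly decreases
the number of agents, while every graph that can be expanded has at least one permitted edge; for the
superflow, removing all the edges into children of `s` together with `s` never creates a cycle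
without siblings (`DirGraph.IsSOC.removeVertex_removeEdges`).
-/

namespace CausalFlow

/-! ### Expansion of leaves -/

section Expansion

variable {V α : Type*} {str : α → DirGraph V} {rel : α → α → Prop} {a₀ : α}

/-- One iteration common to both algorithms: every nontrivial leaf `a` with a source gets all the
edges `a ⟶ b` with `rel a b`. -/
def expandStep (str : α → DirGraph V) (rel : α → α → Prop) (G : DirGraph α) : DirGraph α :=
  G.addEdges fun a b => NontrivialLeafWithSource str G a ∧ rel a b

theorem mem_expandStep {G : DirGraph α} {b : α} (hb : b ∈ (expandStep str rel G).verts) :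
    b ∈ G.verts ∨ ∃ a, NontrivialLeafWithSource str G a ∧ rel a b := by
  rcases hb with hb | ⟨_, hb⟩ | ⟨a, ha⟩
  · exact Or.inl hb
  · exact Or.inl hb.1.1.1
  · exact Or.inr ⟨a, ha⟩

theorem forall_mem_iterate_expandStep {P : α → Prop} (h₀ : P a₀)
    (hP : ∀ a b, P a → rel a b → P b) (k : ℕ) :
    ∀ a ∈ ((expandStep str rel)^[k] (DirGraph.single a₀)).verts, P a := by
  induction k with
  | zero =>
    rintro a rfl
    exact h₀
  | succ k ih =>
    intro b hb
    rw [Function.iterate_succ_apply'] at hb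
    rcases mem_expandStep hb with hb | ⟨a, ha, hab⟩
    · exact ih b hb
    · exact hP a b (ih a ha.1.1) hab

/-- A vertex that has an outgoing edge has been expanded completely. -/
theorem adj_iterate_expandStep_of_adj (k : ℕ) {a b c : α}
    (hab : ((expandStep str rel)^[k] (DirGraph.single a₀)).Adj a b) (hac : rel a c) :
    ((expandStep str rel)^[k] (DirGraph.single a₀)).Adj a c := by
  induction k with
  | zero => exact hab.elim
  | succ k ih =>
    rw [Function.iterate_succ_apply'] at hab ⊢
    rcases hab with hab | hab
    · exact Or.inl (ih hab)
    · exact Or.inr ⟨hab.1, hac⟩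

/-- The nontrivial leaves with a source that are left after `k` iterations have been created by the
`k`-th one (or are the root, for `k = 0`), and thus have lost at least `k` of the agents of the root. -/
theorem ncard_add_le_of_iterate_expandStep {P : α → Prop} (h₀ : P a₀)
    (hP : ∀ a b, P a → rel a b → P b)
    (hex : ∀ a, P a → (∃ s, (str a).IsSource s) → ∃ b, rel a b)
    (hlt : ∀ a b, rel a b → (str b).verts.ncard < (str a).verts.ncard) (k : ℕ) :
    ∀ a, NontrivialLeafWithSource str ((expandStep str rel)^[k] (DirGraph.single a₀)) a →
      (str a).verts.ncard + k ≤ (str a₀).verts.ncard := by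
  induction k with
  | zero =>
    rintro a ⟨⟨rfl, -⟩, -⟩
    exact le_rfl
  | succ k ih =>
    intro b hb
    rw [Function.iterate_succ_apply'] at hb
    obtain ⟨⟨hmem, hleaf⟩, hnt, hs⟩ := hb
    rcases mem_expandStep hmem with hmem | ⟨a, ha, hab⟩
    · -- a leaf that was already present has just been expanded
      obtain ⟨c, hc⟩ := hex b (forall_mem_iterate_expandStep h₀ hP k b hmem) hs
      exact (hleaf c (Or.inr ⟨⟨⟨hmem, fun d hd => hleaf d (Or.inl hd)⟩, hnt, hs⟩, hc⟩)).elim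
    · have := ih a ha
      have := hlt a b hab
      omega

theorem exists_whileReturns_of_iterate {σ : Type*} {done : σ → Prop} {step : σ → σ} {init : σ}
    (h : ∃ k : ℕ, done (step^[k] init)) : ∃ out, WhileReturns done step init out := by
  classical
  exact ⟨_, Nat.find h, fun j hj => Nat.find_min h hj, Nat.find_spec h, rfl⟩

theorem exists_whileReturns_expandStep [Finite V] {P : α → Prop} (h₀ : P a₀)
    (hP : ∀ a b, P a → rel a b → P b)
    (hex : ∀ a, P a → (∃ s, (str a).IsSource s) → ∃ b, rel a b)
    (hlt : ∀ a b, rel a b → (str b).verts.ncard < (str a).verts.ncard) :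
    ∃ G, WhileReturns (fun G => ∀ a, ¬ NontrivialLeafWithSource str G a) (expandStep str rel)
      (DirGraph.single a₀) G := by
  refine exists_whileReturns_of_iterate ⟨(str a₀).verts.ncard, fun a ha => ?_⟩
  have hle := ncard_add_le_of_iterate_expandStep h₀ hP hex hlt _ a ha
  obtain ⟨s, hs⟩ := ha.2.2
  have : 0 < (str a).verts.ncard := (Set.ncard_pos (Set.toFinite _)).2 ⟨s, hs.1⟩
  omega

end Expansion

/-! ### Siblings-on-cycles graphs -/

section SOC

variable {V : Type*}

/-- The edges that the superflow algorithm may add. -/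
def SuperflowRel (L L'' : DirGraph V) : Prop :=
  ∃ s, L.IsSource s ∧ ∃ R ⊆ edgesIntoChildren L s,
    L'' = (L.removeVertex s).removeEdges R ∧ L''.IsSOC

/-- Without `s` and the edges into its children, these children are sources and lie on no cycle, so
every remaining cycle has siblings with a common parent other than `s`. -/
theorem DirGraph.IsSOC.removeVertex_removeEdges {L : DirGraph V} (hL : L.IsSOC) (s : V) :
    ((L.removeVertex s).removeEdges (edgesIntoChildren L s)).IsSOC := by
  rintro n c ⟨hc, hadj⟩
  have hmem : ∀ i, c i ≠ s ∧ ¬ L.Adj s (c i) := by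
    intro i
    have h := hadj (i - 1)
    rw [sub_add_cancel] at h
    exact ⟨h.1.2.2, fun hs => h.2 ⟨hs, h.1⟩⟩
  obtain ⟨i, j, hij, p, hpi, hpj⟩ := hL n c ⟨hc, fun i => (hadj i).1.1⟩
  have hps : p ≠ s := by
    rintro rfl
    exact (hmem i).2 hpi
  exact ⟨i, j, hij, p, ⟨⟨hpi, hps, (hmem i).1⟩, fun h => (hmem i).2 h.1⟩,
    ⟨⟨hpj, hps, (hmem j).1⟩, fun h => (hmem j).2 h.1⟩⟩

theorem DirGraph.ncard_removeVertex_lt [Finite V] {L : DirGraph V} {s : V} (hs : s ∈ L.verts) :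
    (L.removeVertex s).verts.ncard < L.verts.ncard :=
  Set.ncard_sdiff_singleton_lt_of_mem hs (Set.toFinite _)

theorem exists_superflowReturns [Finite V] {D : DirGraph V} (hD : D.IsSOC) :
    ∃ S, SuperflowReturns D S := by
  refine exists_whileReturns_expandStep (str := id) (rel := SuperflowRel)
    (P := DirGraph.IsSOC) hD ?_ ?_ ?_
  · rintro _ _ - ⟨_, _, _, _, _, h⟩
    exact h
  · rintro L hL ⟨s, hs⟩
    exact ⟨_, s, hs, _, subset_rfl, rfl, hL.removeVertex_removeEdges s⟩
  · rintro L _ ⟨s, hs, R, _, rfl, _⟩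
    exact DirGraph.ncard_removeVertex_lt hs.1

end SOC

namespace CausalModel

variable {V : Type*} {O I : V → Type*}

/-! ### Unique fixed points -/

/-- The input of `v` when all agents produce the outputs `o`. -/
def input (M : CausalModel O I) (o : ∀ v : M.graph.verts, O v) (v : M.graph.verts) : I v :=
  M.param v fun u => o ⟨u, M.graph.left_mem u.2⟩

/-- For any choice of functions from inputs to outputs, exactly one assignment of outputs
reproduces itself. -/
def HasUniqueFixedPoints (M : CausalModel O I) : Prop :=
  ∀ f : (∀ v : M.graph.verts, I v → O v),
    ∃! o : (∀ v : M.graph.verts, O v), ∀ v, f v (M.input o v) = o v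

theorem Consistent.hasUniqueFixedPoints [Finite V] [∀ v, Finite (O v)] [∀ v, Finite (I v)]
    {M : CausalModel O I} {X A : V → Type*} [∀ v, Nonempty (X v)] [∀ v, Nonempty (A v)]
    (hM : M.Consistent X A) : M.HasUniqueFixedPoints := by
  classical
  intro f
  obtain ⟨g, hg⟩ := hM fun v xi => (Classical.arbitrary (A v), f v xi.2)
  set x : ∀ v : M.graph.verts, X v := fun v => Classical.arbitrary (X v)
  specialize hg x (g x)
  set F : (∀ v : M.graph.verts, I v) × (∀ v : M.graph.verts, O v) → ℕ := fun io =>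
    bracket (∀ v : M.graph.verts,
        M.param v (fun u => io.2 ⟨u, M.graph.left_mem u.2⟩) = io.1 v) *
      bracket (∀ v : M.graph.verts,
        (Classical.arbitrary (A v), f v (io.1 v)) = (g x v, io.2 v)) with hF
  have hsum : ∑ᶠ io, F io = 1 := by
    rw [hF, hg]
    simp [bracket]
  have hF_eq : ∀ o, F (M.input o, o) = bracket (∀ v : M.graph.verts,
      (Classical.arbitrary (A v), f v (M.input o v)) = (g x v, o v)) := by
    intro o
    simp [hF, bracket, input]
  -- A solution exists because the sum does not vanish.
  obtain ⟨⟨i, o⟩, hio⟩ : ∃ io, F io ≠ 0 := by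
    by_contra! h
    simp [h] at hsum
  have hio' : (∀ v, M.input o v = i v) ∧ ∀ v : M.graph.verts,
      (Classical.arbitrary (A v), f v (i v)) = (g x v, o v) := by
    simp only [hF, bracket, ne_eq, mul_eq_zero, not_or] at hio
    exact ⟨by simpa [input] using hio.1, by simpa using hio.2⟩
  obtain ⟨hi, ho⟩ := hio'
  obtain rfl : M.input o = i := funext hi
  refine ⟨o, fun v => (Prod.ext_iff.1 (ho v)).2, fun o' ho' => ?_⟩
  -- A second solution would contribute another one to the sum.
  by_contra hne
  have h1 : F (M.input o, o) = 1 := by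
    rw [hF_eq]
    exact if_pos ho
  have h2 : F (M.input o', o') = 1 := by
    rw [hF_eq]
    exact if_pos fun v => Prod.mk.injEq .. ▸ ⟨(Prod.ext_iff.1 (ho v)).1, ho' v⟩
  have hfin := Fintype.ofFinite ((∀ v : M.graph.verts, I v) × (∀ v : M.graph.verts, O v))
  rw [finsum_eq_sum_of_fintype] at hsum
  have hpair := Finset.sum_le_sum_of_subset (f := F)
    (Finset.subset_univ {(M.input o, o), (M.input o', o')})
  rw [Finset.sum_pair (fun h => hne (Prod.ext_iff.1 h).2.symm), h1, h2, hsum] at hpair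
  omega

theorem isSOC_of_hasUniqueFixedPoints [∀ v, Nonempty (O v)] {M : CausalModel O I}
    (hM : M.HasUniqueFixedPoints) (hf : M.Faithful) : M.graph.IsSOC := by
  classical
  rintro n c ⟨hc, hadj⟩
  by_contra! hsib
  have huniq : ∀ {u : V} {i j : Fin (n + 1)}, M.graph.Adj u (c (i + 1)) →
      M.graph.Adj u (c (j + 1)) → i = j := by
    intro u i j hi hj
    by_contra hij
    exact hsib (i + 1) (j + 1) ⟨fun h => hij (add_right_cancel (hc h)), u, hi, hj⟩
  choose h o q r hqr using fun i => hf _ _ (hadj i)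
  -- The outputs `t i` of `c i`, combined with the witnesses for the other parents of `c (i + 1)`.
  let W : (∀ i, O (c i)) → ∀ u : V, O u := fun t u =>
    if hu : ∃ i, M.graph.Adj u (c (i + 1)) then
      Function.update (o hu.choose) ⟨c hu.choose, h hu.choose⟩ (t hu.choose) ⟨u, hu.choose_spec⟩
    else Classical.arbitrary (O u)
  have hW : ∀ t i (u : {u : V // M.graph.Adj u (c (i + 1))}),
      W t u = Function.update (o i) ⟨c i, h i⟩ (t i) u := by
    rintro t i ⟨u, hu⟩
    have hex : ∃ i, M.graph.Adj u (c (i + 1)) := ⟨i, hu⟩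
    obtain rfl : hex.choose = i := huniq hex.choose_spec hu
    exact dif_pos hex
  have hWout : ∀ t t' u, (∀ i, u ≠ c i) → W t u = W t' u := by
    intro t t' u hu
    by_cases hex : ∃ i, M.graph.Adj u (c (i + 1))
    · obtain ⟨i, hi⟩ := hex
      have hne : (⟨u, hi⟩ : {u : V // M.graph.Adj u (c (i + 1))}) ≠ ⟨c i, h i⟩ :=
        fun h => hu i (congrArg Subtype.val h)
      rw [hW t i ⟨u, hi⟩, hW t' i ⟨u, hi⟩, Function.update_of_ne hne, Function.update_of_ne hne]
    · simp only [W, dif_neg hex]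
  let Q : ∀ v : M.graph.verts, O v := fun v => W q v
  let R : ∀ v : M.graph.verts, O v := fun v => W r v
  have hne : ∀ j (hj : c j ∈ M.graph.verts), M.input Q ⟨c j, hj⟩ ≠ M.input R ⟨c j, hj⟩ := by
    intro j hj
    obtain ⟨i, rfl⟩ : ∃ i, j = i + 1 := ⟨j - 1, (sub_add_cancel j 1).symm⟩
    have hQ : M.input Q ⟨c (i + 1), M.graph.right_mem (h i)⟩ =
        M.param ⟨c (i + 1), M.graph.right_mem (h i)⟩
          (Function.update (o i) ⟨c i, h i⟩ (q i)) :=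
      congrArg (M.param ⟨c (i + 1), M.graph.right_mem (h i)⟩) (funext (hW q i))
    have hR : M.input R ⟨c (i + 1), M.graph.right_mem (h i)⟩ =
        M.param ⟨c (i + 1), M.graph.right_mem (h i)⟩
          (Function.update (o i) ⟨c i, h i⟩ (r i)) :=
      congrArg (M.param ⟨c (i + 1), M.graph.right_mem (h i)⟩) (funext (hW r i))
    rw [hQ, hR]
    convert hqr i
  -- `R` is reproduced too: off the cycle `Q` and `R` agree, on it their inputs differ.
  obtain ⟨o', -, ho'⟩ := hM fun v i => if i = M.input Q v then Q v else R v
  have hQR : Q = R := by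
    rw [ho' Q fun v => if_pos rfl, ho' R fun v => ?_]
    split_ifs with hv
    · refine hWout q r v fun i hi => ?_
      obtain ⟨v, hvm⟩ := v
      obtain rfl : v = c i := hi
      exact hne i hvm hv.symm
    · rfl
  exact hne 0 (M.graph.left_mem (h 0)) (by rw [hQR])

/-! ### Reduction over a source -/

/-- The outputs of the remaining agents, completed by the output `os` of `s`. -/
noncomputable def extendOutputs (M : CausalModel O I) (s : V) (os : O s)
    (o : ∀ v : (M.graph.removeVertex s).verts, O v) : ∀ v : M.graph.verts, O v :=
  open scoped Classical in
  fun v => if h : (v : V) = s then cast (congrArg O h.symm) os else o ⟨v, v.2, h⟩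

theorem extendOutputs_of_ne (M : CausalModel O I) {s : V} (os : O s)
    (o : ∀ v : (M.graph.removeVertex s).verts, O v) {v : V} (hv : v ∈ M.graph.verts) (h : v ≠ s) :
    M.extendOutputs s os o ⟨v, hv⟩ = o ⟨v, hv, h⟩ :=
  dif_neg h

theorem HasUniqueFixedPoints.reduce {M : CausalModel O I} (hM : M.HasUniqueFixedPoints)
    {s : V} (hs : s ∈ M.graph.verts) (os : O s) : (M.reduce s os).HasUniqueFixedPoints := by
  classical
  intro f
  obtain ⟨o, ho, huniq⟩ := hM fun v i =>
    if h : (v : V) = s then cast (congrArg O h.symm) os else f ⟨v, v.2, h⟩ i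
  have hos : o ⟨s, hs⟩ = os := by
    rw [← ho ⟨s, hs⟩]
    simp
  let o' : ∀ v : (M.graph.removeVertex s).verts, O v := fun v => o ⟨v, v.2.1⟩
  have ho' : M.extendOutputs s os o' = o := by
    funext v
    obtain ⟨v, hv⟩ := v
    by_cases h : v = s
    · subst h
      simp [extendOutputs, hos]
    · simp [extendOutputs, h, o']
  refine ⟨o', fun v => ?_, fun p hp => ?_⟩
  · have hv := ho ⟨v, v.2.1⟩
    rw [dif_neg (show (v : V) ≠ s from v.2.2)] at hv
    -- by definition, the inputs after reduction are the inputs of `M` for the completed outputs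
    exact (congrArg (f v) (congrFun (congrArg M.input ho') ⟨v, v.2.1⟩)).trans hv
  · have hp' : M.extendOutputs s os p = o := by
      refine huniq _ fun v => ?_
      obtain ⟨v, hv⟩ := v
      by_cases h : v = s
      · simp [extendOutputs, h]
      · rw [dif_neg h]
        exact (hp ⟨v, hv, h⟩).trans (M.extendOutputs_of_ne os p hv h).symm
    funext v
    have hv : M.extendOutputs s os p ⟨v, v.2.1⟩ = p v :=
      M.extendOutputs_of_ne os p v.2.1 v.2.2
    rw [← hv, hp']

/-- Reduction over `s` leaves the parameters of agents other than children of `s` unchanged. -/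
theorem signals_reduce {M : CausalModel O I} {s : V} (os : O s) {l v : V}
    (h : (M.graph.removeVertex s).Adj l v) (hs : ¬ M.graph.Adj s v) (hM : M.Signals l v) :
    (M.reduce s os).Signals l v := by
  classical
  obtain ⟨hadj, o, q, r, hqr⟩ := hM
  let e : {u : V // (M.graph.removeVertex s).Adj u v} → {u : V // M.graph.Adj u v} :=
    fun u => ⟨u, u.2.1⟩
  have key : ∀ t, (M.reduce s os).param ⟨v, (M.graph.removeVertex s).right_mem h⟩
      (Function.update (fun u => o (e u)) ⟨l, h⟩ t) =
        M.param ⟨v, M.graph.right_mem hadj⟩ (Function.update o ⟨l, hadj⟩ t) := by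
    intro t
    refine congrArg (M.param ⟨v, M.graph.right_mem hadj⟩) (funext fun u => ?_)
    obtain ⟨u, hu⟩ := u
    have hus : u ≠ s := by
      rintro rfl
      exact hs hu
    by_cases hul : u = l
    · subst hul
      exact (dif_neg hus).trans
        ((Function.update_self ..).trans
          (Function.update_self (⟨u, hadj⟩ : {w // M.graph.Adj w v}) t o).symm)
    · exact (dif_neg hus).trans
        ((Function.update_of_ne (fun h => hul (congrArg Subtype.val h)) ..).trans
          (Function.update_of_ne (fun h => hul (congrArg Subtype.val h)) ..).symm)
  refine ⟨h, fun u => o (e u), q, r, fun heq => hqr ?_⟩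
  have := (key q).symm.trans (Eq.trans (by convert heq) (key r))
  convert this

/-! ### Derivation of the causal structure -/

/-- For finitely many agents, the parameter of `v` is determined by the outputs of the parents from
which it is signaling. -/
theorem param_eq_of_forall_signals [Finite V] (M : CausalModel O I) (v : M.graph.verts)
    {o o' : ∀ u : {u : V // M.graph.Adj u v}, O u}
    (h : ∀ u : {u : V // M.graph.Adj u v}, M.Signals u v → o u = o' u) :
    M.param v o = M.param v o' := by
  classical
  have hfin := Fintype.ofFinite {u : V // M.graph.Adj u v}
  have key : ∀ t : Finset {u : V // M.graph.Adj u v},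
      M.param v (t.piecewise o' o) = M.param v o := by
    intro t
    induction t using Finset.induction_on with
    | empty => simp
    | insert a t ha ih =>
      rw [Finset.piecewise_insert, ← ih]
      by_cases hs : M.Signals a v
      · rw [← h a hs]
        congr 1
        refine Function.update_eq_self_iff.2 ?_
        simp [ha]
      · by_contra hne
        refine hs ⟨a.2, t.piecewise o' o, o' a, t.piecewise o' o a, fun heq => hne ?_⟩
        refine Eq.trans ?_ (heq.trans ?_)
        · congr!
        · congr 1
          exact Function.update_eq_self _ _
  simpa using (key Finset.univ).symm

variable [Finite V] [∀ v, Nonempty (O v)]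

theorem input_derive (M : CausalModel O I) (o : ∀ v : M.graph.verts, O v) (v : M.graph.verts) :
    M.derive.input o v = M.input o v :=
  M.param_eq_of_forall_signals v fun _ hu => dif_pos hu

theorem HasUniqueFixedPoints.derive {M : CausalModel O I} (hM : M.HasUniqueFixedPoints) :
    M.derive.HasUniqueFixedPoints := by
  intro f
  obtain ⟨o, ho, huniq⟩ := hM f
  refine ⟨o, fun v => ?_, fun p hp => huniq p fun v => ?_⟩
  · exact (congrArg (f v) (M.input_derive o v)).trans (ho v)
  · exact (congrArg (f v) (M.input_derive p v)).symm.trans (hp v)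

theorem faithful_derive (M : CausalModel O I) : M.derive.Faithful := by
  classical
  intro l v h
  obtain ⟨hadj, o, q, r, hqr⟩ := id h
  have key : ∀ t, M.derive.param ⟨v, M.graph.right_mem hadj⟩
      (Function.update (fun u => o ⟨u, u.2.1⟩) ⟨l, h⟩ t) =
        M.param ⟨v, M.graph.right_mem hadj⟩ (Function.update o ⟨l, hadj⟩ t) := by
    intro t
    refine M.param_eq_of_forall_signals ⟨v, M.graph.right_mem hadj⟩ fun u hu => ?_
    obtain ⟨u, hadj'⟩ := u
    rw [dif_pos hu]
    by_cases hul : u = l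
    · subst hul
      exact (Function.update_self ..).trans
        (Function.update_self (⟨u, hadj⟩ : {w // M.graph.Adj w v}) t o).symm
    · exact (Function.update_of_ne (fun h => hul (congrArg Subtype.val h)) ..).trans
        (Function.update_of_ne (fun h => hul (congrArg Subtype.val h)) ..).symm
  refine ⟨h, fun u => o ⟨u, u.2.1⟩, q, r, fun heq => hqr ?_⟩
  have := (key q).symm.trans (Eq.trans (by convert heq) (key r))
  convert this

/-! ### The flow -/

/-- The edges that the flow algorithm may add. -/
def FlowRel (M N : CausalModel O I) : Prop :=
  ∃ s, M.graph.IsSource s ∧ ∃ os : O s, N = (M.reduce s os).derive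

theorem HasUniqueFixedPoints.of_flowRel {M N : CausalModel O I}
    (hM : M.HasUniqueFixedPoints) (h : FlowRel M N) : N.HasUniqueFixedPoints ∧ N.Faithful := by
  obtain ⟨s, hs, os, rfl⟩ := h
  exact ⟨(hM.reduce hs.1 os).derive, faithful_derive _⟩

/-- Forgetting the parameters turns edges of the flow algorithm into permitted edges of the
superflow algorithm. -/
theorem FlowRel.superflowRel {M N : CausalModel O I} (hM : M.HasUniqueFixedPoints)
    (hf : M.Faithful) (h : FlowRel M N) : SuperflowRel M.graph N.graph := by
  have hN := hM.of_flowRel h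
  have hSOC := isSOC_of_hasUniqueFixedPoints hN.1 hN.2
  obtain ⟨s, hs, os, rfl⟩ := h
  refine ⟨s, hs, {e | (M.graph.removeVertex s).Adj e.1 e.2 ∧ ¬ (M.reduce s os).Signals e.1 e.2},
    ?_, ?_, hSOC⟩
  · rintro ⟨l, v⟩ ⟨hadj, hsig⟩
    refine ⟨?_, hadj⟩
    by_contra hsv
    exact hsig (signals_reduce os hadj hsv (hf l v hadj.1))
  · refine DirGraph.ext rfl ?_
    funext l v
    refine propext ⟨fun h => ⟨h.1, fun h' => h'.2 h⟩, fun h => ?_⟩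
    by_contra h'
    exact h.2 ⟨h.1, h'⟩

theorem exists_flowReturns (M : CausalModel O I) : ∃ F, FlowReturns M F := by
  obtain ⟨G, hG⟩ := exists_whileReturns_expandStep (str := CausalModel.graph) (rel := FlowRel)
    (a₀ := M) (P := fun _ => True) trivial (fun _ _ _ _ => trivial)
    (by
      rintro N - ⟨s, hs⟩
      exact ⟨_, s, hs, Classical.arbitrary (O s), rfl⟩)
    (by
      rintro N _ ⟨s, hs, os, rfl⟩
      exact DirGraph.ncard_removeVertex_lt hs.1)
  exact ⟨_, G, hG, rfl⟩

theorem isSubgraph_of_flowReturns {M : CausalModel O I} (hM : M.HasUniqueFixedPoints)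
    (hf : M.Faithful) {F S : DirGraph (DirGraph V)} (hF : FlowReturns M F)
    (hS : SuperflowReturns M.graph S) : F.IsSubgraph S := by
  obtain ⟨_, ⟨k, -, -, rfl⟩, rfl⟩ := hF
  obtain ⟨m, -, hdone, hSm⟩ := hS
  rw [← hSm] at hdone
  change S = (expandStep id SuperflowRel)^[m] (DirGraph.single M.graph) at hSm
  have hroot : M.graph ∈ S.verts := by
    rw [hSm]
    clear hSm
    induction m with
    | zero => exact rfl
    | succ m ih =>
      rw [Function.iterate_succ_apply']
      exact Or.inl ih
  -- The superflow has no expandable leaves left, so its expandable vertices have all their edges.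
  have hcomplete : ∀ L L'', L ∈ S.verts → ¬ L.IsTrivial → (∃ s, L.IsSource s) →
      SuperflowRel L L'' → S.Adj L L'' := by
    intro L L'' hL hnt hs hrel
    obtain ⟨K, hK⟩ : ∃ K, S.Adj L K := by
      by_contra! h
      exact hdone L ⟨⟨hL, h⟩, hnt, hs⟩
    rw [hSm] at hK ⊢
    exact adj_iterate_expandStep_of_adj m hK hrel
  have hprop := forall_mem_iterate_expandStep (str := CausalModel.graph) (rel := FlowRel)
    (P := fun N : CausalModel O I => N.HasUniqueFixedPoints ∧ N.Faithful) ⟨hM, hf⟩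
    (fun _ _ hN h => hN.1.of_flowRel h)
  change ((expandStep CausalModel.graph FlowRel)^[k] (DirGraph.single M)).image _ |>.IsSubgraph S
  suffices h : (∀ N ∈ ((expandStep CausalModel.graph FlowRel)^[k] (DirGraph.single M)).verts,
      N.graph ∈ S.verts) ∧
      ∀ N N', ((expandStep CausalModel.graph FlowRel)^[k] (DirGraph.single M)).Adj N N' →
        S.Adj N.graph N'.graph by
    refine ⟨?_, ?_⟩
    · rintro _ ⟨N, hN, rfl⟩
      exact h.1 N hN
    · rintro _ _ ⟨N, N', hadj, rfl, rfl⟩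
      exact h.2 N N' hadj
  induction k with
  | zero =>
    refine ⟨?_, fun _ _ h => h.elim⟩
    rintro N rfl
    exact hroot
  | succ k ih =>
    have hnew : ∀ N N', NontrivialLeafWithSource CausalModel.graph
        ((expandStep CausalModel.graph FlowRel)^[k] (DirGraph.single M)) N → FlowRel N N' →
        S.Adj N.graph N'.graph := by
      intro N N' hN hrel
      obtain ⟨hu, hfa⟩ := hprop k N hN.1.1
      exact hcomplete _ _ (ih.1 N hN.1.1) hN.2.1 hN.2.2 (hrel.superflowRel hu hfa)
    rw [Function.iterate_succ_apply']
    refine ⟨fun N hN => ?_, fun N N' hadj => ?_⟩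
    · rcases mem_expandStep hN with hN | ⟨N', hN', hrel⟩
      · exact ih.1 N hN
      · exact S.right_mem (hnew N' N hN' hrel)
    · rcases hadj with hadj | hadj
      · exact ih.2 N N' hadj
      · exact hnew N N' hadj.1 hadj.2

end CausalModel

theorem DirGraph.IsPath.of_isSubgraph {α : Type*} {G H : DirGraph α} (h : G.IsSubgraph H)
    {p : List α} (hp : G.IsPath p) : H.IsPath p :=
  ⟨hp.1, fun a ha => h.1 (hp.2.1 a ha), hp.2.2.imp fun a b => h.2 a b⟩

end CausalFlow

theorem mainTheorem3 {V : Type*} [Finite V] {O I : V → Type*}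
    [∀ v, Finite (O v)] [∀ v, Nonempty (O v)] [∀ v, Finite (I v)]
    (X A : V → Type*) [∀ v, Nonempty (X v)] [∀ v, Nonempty (A v)] :
    (∀ D : CausalFlow.DirGraph V, D.IsSOC → ∃ S, CausalFlow.SuperflowReturns D S) ∧
    ∀ M : CausalFlow.CausalModel O I, M.Consistent X A → M.Faithful →
      (∃ S, CausalFlow.SuperflowReturns M.graph S) ∧
      (∃ F, CausalFlow.FlowReturns M F) ∧
      ∀ F S : CausalFlow.DirGraph (CausalFlow.DirGraph V),
        CausalFlow.FlowReturns M F → CausalFlow.SuperflowReturns M.graph S →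
          F.IsSubgraph S ∧
            ∀ p : List (CausalFlow.DirGraph V), F.IsPath p → S.IsPath p := by
  refine ⟨fun D hD => CausalFlow.exists_superflowReturns hD, fun M hM hf => ?_⟩
  have hu := hM.hasUniqueFixedPoints
  refine ⟨CausalFlow.exists_superflowReturns
    (CausalFlow.CausalModel.isSOC_of_hasUniqueFixedPoints hu hf),
    M.exists_flowReturns, fun F S hF hS => ?_⟩
  have hsub := CausalFlow.CausalModel.isSubgraph_of_flowReturns hu hf hF hS
  exact ⟨hsub, fun p hp => hp.of_isSubgraph hsub⟩
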